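/- Let $\mathcal X=\mathbb R^D$, $\mathcal Y=\mathbb R$, and identify functions $\mathcal X\to\mathcal Y^M$ with elements of $(\mathcal Y^{\mathcal X})^M$, equipped with the cylinder $\sigma$-algebra. Let $A=(A_1,\dots,A_M)$ be processes over $\mathcal X\times(\mathcal Y^{\mathcal X})^M$ with $A_i\sim\mathcal{GP}(0,k_{A_i})$, let $u=(u_1,\dots,u_M)$ be processes over $\mathcal X$ with $u_i\sim\mathcal{GP}(0,k_{u_i})$, and let $A_1,\dots,A_M,u_1,\dots,u_M$ be independent. Suppose that $A_i(x,y)$ depends only on $(x,y_{1:i-1})$, so that $k_{A_i}=k_{A_i}(x,y_{1:i-1},x',y'_{1:i-1})$, and that $A_1=0$. For $f\colon\mathcal X\to\mathcal Y^M$ put $A\circ f=A(\cdot,f)$ and $\mathrm T f=u+A\circ f$, and let $\mathrm T^{N}$ denote $N$ consecutive applications of $\mathrm T$. Regularity convention: there is a set $S\subseteq\mathcal Y^{\mathcal X}$ of sample paths (for example $S=\mathcal Y^{\mathcal X}$) such that $u\in S^M$, $\mathrm T$ maps $S^M$ into itself, and for all $i$ and $x$ the map $(\omega,y)\mapsto A_i(\omega)(x,y)$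 is jointly measurable on $\Omega\times S^M$ with respect to $\sigma(A_i)\otimes\mathcal C$, where $\mathcal C$ is the trace of the cylinder $\sigma$-algebra on $S^M$. Let $g=(g_1,\dots,g_M)$ be an $M$-dimensional vector-valued process over $\mathcal X$ with sample paths in $S^M$. Then $g$ is distributed according to the model $g\mid A,u=\mathrm T^{M-1}u$, that is, $g$ has the same law as $\mathrm T^{M-1}u$, if and only if, for every $i=1,\dots,M$, $$g_i\mid g_{1:i-1}\ \sim\ \mathcal{GP}\bigl(0,\;k_{u_i}+k_{A_i}(\cdot,g_{1:i-1},\cdot,g_{1:i-1})\bigr),$$ that is, for every finite $I\subseteq\mathcal X$ the regular conditional distribution of $(g_i(x))_{x\in I}$ given $g_{1:i-1}$ is almost surely the centred Gaussian law with covariance matrix $\bigl(k_{u_i}(x,x')+k_{A_i}(x,g_{1:i-1},x',g_{1:i-1})\bigr)_{x,x'\in I}$. -/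

import Mathlib

open MeasureTheory ProbabilityTheory

noncomputable section

namespace GPAR

/-- The input space `𝒳 = ℝ^D`. -/
abbrev Input (D : ℕ) : Type := EuclideanSpace ℝ (Fin D)

/-- Elements of `(𝒴^𝒳)^n` with `𝒴 = ℝ` and components indexed by `ι`; this is identified with the
set of functions `𝒳 → 𝒴^n`. It carries the product (cylinder) σ-algebra. -/
abbrev Paths (D : ℕ) (ι : Type) : Type := ι → Input D → ℝ

/-- The components `f_{1:i-1}` of `f` that come strictly before the `i`-th one. -/
def preceding {D M : ℕ} (i : Fin M) (f : Paths D (Fin M)) : Paths D (Set.Iio i) :=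
  fun j => f j

/-- `A ∘ f = A(·, f)`, for `A : 𝒳 × (𝒴^𝒳)^M → 𝒴^M` given by its `M` components. -/
def comp {D M : ℕ} (A : Fin M → Input D × Paths D (Fin M) → ℝ) (f : Paths D (Fin M)) :
    Paths D (Fin M) :=
  fun i x => A i (x, f)

/-- The operator `T f = u + A ∘ f`. -/
def opT {D M : ℕ} (A : Fin M → Input D × Paths D (Fin M) → ℝ) (u f : Paths D (Fin M)) :
    Paths D (Fin M) :=
  u + comp A f

/-- The random function `f` on the index set `T` is a Gaussian process `GP(0, k)` under `P`. -/
structure IsGP {Ω T : Type*} [MeasurableSpace Ω] (f : Ω → T → ℝ) (k : T → T → ℝ)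
    (P : Measure Ω) : Prop where
  measurable : ∀ t, Measurable (fun ω => f ω t)
  gaussian : IsGaussianProcess (fun t ω => f ω t) P
  mean : ∀ t, ∫ ω, f ω t ∂P = 0
  cov : ∀ s t, covariance (fun ω => f ω s) (fun ω => f ω t) P = k s t

/-- `ν` is the (possibly degenerate) Gaussian law `N(0, K)` on `ℝ^ι`. -/
structure IsCenteredGaussian {ι : Type*} (ν : Measure (ι → ℝ)) (K : ι → ι → ℝ) : Prop where
  gaussian : IsGaussian ν
  mean : ∀ i, ∫ z, z i ∂ν = 0
  cov : ∀ i j, covariance (fun z => z i) (fun z => z j) ν = K i j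

/-- `f | Y ~ GP(0, k(Y))`: for every finite set `I` of inputs, the regular conditional
distribution of `(f(x))_{x ∈ I}` given `Y` is almost surely `N(0, (k(Y)(x, x'))_{x, x' ∈ I})`. -/
def IsCondGP {Ω T E : Type*} [MeasurableSpace Ω] [MeasurableSpace E] (f : Ω → T → ℝ)
    (Y : Ω → E) (k : E → T → T → ℝ) (P : Measure Ω) [IsFiniteMeasure P] : Prop :=
  ∀ I : Finset T, ∀ᵐ ω ∂P,
    IsCenteredGaussian (condDistrib (fun ω' (x : I) => f ω' x) Y P (Y ω))
      (fun x x' => k (Y ω) x x')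

/-- Measurability of a random function `a` on `𝒳 × (𝒴^𝒳)^M` which makes it possible to insert
random functions with values in `S ⊆ 𝒴^𝒳` into it: for each `x`, the value `a(x, y)` is a jointly
measurable function of the random function `a` (through the σ-algebra that `a` generates) and of
`y ∈ S^M` (with the trace of the cylinder σ-algebra). -/
def JointlyMeasurable {Ω : Type*} {D M : ℕ} (S : Set (Input D → ℝ))
    (a : Ω → Input D × Paths D (Fin M) → ℝ) : Prop :=
  ∀ x : Input D,
    Measurable[(MeasurableSpace.comap a inferInstance).prod
        (inferInstance : MeasurableSpace (Fin M → S))]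
      (fun p : Ω × (Fin M → S) => a p.1 (x, fun j => (p.2 j : Input D → ℝ)))

end GPAR

end

open GPAR

namespace GPAR

section Gaussian

/-- A centred Gaussian law on a finite product is determined by its covariance matrix. -/
theorem IsCenteredGaussian.unique {ι : Type*} [Fintype ι] {ν ν' : Measure (ι → ℝ)}
    {K : ι → ι → ℝ} (h : IsCenteredGaussian ν K) (h' : IsCenteredGaussian ν' K) : ν = ν' := by
  classical
  have key : ∀ {ρ : Measure (ι → ℝ)}, IsCenteredGaussian ρ K → ∀ L : StrongDual ℝ (ι → ℝ),
      charFunDual ρ L = Complex.exp (-((∑ i, ∑ j, L (Pi.single i 1) * (L (Pi.single j 1) * K i j)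
        : ℝ) : ℂ) / 2) := by
    intro ρ hρ L
    have := hρ.gaussian
    obtain ⟨c, hc⟩ : ∃ c : ι → ℝ, ∀ i, L (Pi.single i 1) = c i := ⟨_, fun _ => rfl⟩
    simp_rw [hc]
    have hLf : (⇑L) = fun z => ∑ i, c i * z i := by
      funext z
      conv_lhs => rw [pi_eq_sum_univ' z]
      simp only [map_sum, map_smul, smul_eq_mul, ← hc]
      refine Finset.sum_congr rfl fun i _ => ?_
      rw [mul_comm]
    have hmem : ∀ i, MemLp (fun z : ι → ℝ => z i) 2 ρ := fun i =>
      IsGaussian.memLp_dual ρ (ContinuousLinearMap.proj i) 2 (by norm_num)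
    have hmem' : ∀ i, MemLp (fun z : ι → ℝ => c i * z i) 2 ρ := fun i =>
      (hmem i).const_mul _
    rw [IsGaussian.charFunDual_eq]
    have hmean : ∫ z, L z ∂ρ = 0 := by
      rw [hLf, integral_finsetSum _ fun i _ => (hmem' i).integrable (by norm_num)]
      simp [integral_const_mul, hρ.mean]
    have hvar : Var[L; ρ] = ∑ i, ∑ j, c i * (c j * K i j) := by
      rw [← covariance_self L.continuous.aemeasurable, hLf,
        covariance_fun_sum_fun_sum hmem' hmem']
      simp_rw [covariance_const_mul_left, covariance_const_mul_right, hρ.cov]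
    rw [integral_complex_ofReal, hmean, hvar]
    congr 1
    push_cast
    ring
  have := h.gaussian
  have := h'.gaussian
  apply Measure.ext_of_charFunDual
  ext L
  rw [key h, key h']

variable {Ω T T' ι : Type*} [MeasurableSpace Ω] {P : Measure Ω}

theorem IsGP.hasGaussianLaw_comp [Fintype ι] {f : Ω → T → ℝ} {k : T → T → ℝ} (hf : IsGP f k P)
    (p : ι → T) : HasGaussianLaw (fun ω i => f ω (p i)) P :=
  ((hf.gaussian.comp_right p).hasGaussianLaw Finset.univ).map_fun
    (ContinuousLinearMap.pi fun i : ι =>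
      ContinuousLinearMap.proj (R := ℝ) (φ := fun _ : (Finset.univ : Finset ι) => ℝ)
        ⟨i, Finset.mem_univ i⟩)

theorem IsGP.memLp_two {f : Ω → T → ℝ} {k : T → T → ℝ} (hf : IsGP f k P) (t : T) :
    MemLp (fun ω => f ω t) 2 P :=
  (hf.gaussian.hasGaussianLaw_eval t).memLp_two

/-- The sum of two independent Gaussian processes has centred Gaussian finite-dimensional laws, and
the kernels add up. -/
theorem isCenteredGaussian_map_add [IsProbabilityMeasure P] [Fintype ι]
    {f : Ω → T → ℝ} {a : Ω → T' → ℝ} {k : T → T → ℝ} {l : T' → T' → ℝ}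
    (hf : IsGP f k P) (ha : IsGP a l P) (hind : IndepFun f a P) (p : ι → T) (q : ι → T') :
    IsCenteredGaussian (P.map fun ω i => f ω (p i) + a ω (q i))
      (fun i j => k (p i) (p j) + l (q i) (q j)) := by
  have hm : Measurable fun ω i => f ω (p i) + a ω (q i) :=
    measurable_pi_lambda _ fun i => (hf.measurable _).add (ha.measurable _)
  have hind' : ∀ s t, IndepFun (fun ω => f ω s) (fun ω => a ω t) P := fun s t =>
    hind.comp (measurable_pi_apply s) (measurable_pi_apply t)
  refine ⟨?_, fun i => ?_, fun i j => ?_⟩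
  · have hI : IndepFun (fun ω i => f ω (p i)) (fun ω i => a ω (q i)) P :=
      hind.comp (φ := fun z i => z (p i)) (ψ := fun z i => z (q i))
        (measurable_pi_lambda _ fun i => measurable_pi_apply _)
        (measurable_pi_lambda _ fun i => measurable_pi_apply _)
    exact (iIndepFun.hasGaussianLaw_add (hf.hasGaussianLaw_comp p)
      (ha.hasGaussianLaw_comp q) hI).isGaussian_map
  · rw [integral_map hm.aemeasurable (measurable_pi_apply i).aestronglyMeasurable,
      integral_add ((hf.memLp_two _).integrable (by norm_num))
        ((ha.memLp_two _).integrable (by norm_num)), hf.mean, ha.mean, add_zero]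
  · rw [covariance_map_fun (measurable_pi_apply i).aestronglyMeasurable
      (measurable_pi_apply j).aestronglyMeasurable hm.aemeasurable]
    have h1 := covariance_add_left (hf.memLp_two (p i)) (ha.memLp_two (q i))
      ((hf.memLp_two (p j)).add (ha.memLp_two (q j)))
    rw [covariance_add_right (hf.memLp_two _) (hf.memLp_two _) (ha.memLp_two _),
      covariance_add_right (ha.memLp_two _) (hf.memLp_two _) (ha.memLp_two _),
      hf.cov, ha.cov, (hind' _ _).covariance_eq_zero (hf.memLp_two _) (ha.memLp_two _),
      covariance_comm (fun ω => a ω (q i)),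
      (hind' _ _).covariance_eq_zero (hf.memLp_two _) (ha.memLp_two _), add_zero, zero_add] at h1
    exact h1

end Gaussian

section Laws

/-- Laws on a space whose σ-algebra is pulled back along `v` are determined by their image. -/
theorem map_injective_of_eq_comap {E F : Type*} [mE : MeasurableSpace E] [mF : MeasurableSpace F]
    {v : E → F} (hv : mE = mF.comap v) {μ ν : Measure E} (h : μ.map v = ν.map v) : μ = ν := by
  have hvm : Measurable v := by rw [hv]; exact comap_measurable v
  ext s hs
  rw [hv] at hs
  obtain ⟨t, ht, rfl⟩ := hs
  rw [← Measure.map_apply hvm ht, h, Measure.map_apply hvm ht]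

/-- The joint law of a random variable and a process is determined by the joint laws of that
random variable with the finite-dimensional projections of the process. -/
theorem map_prodMk_eq_of_forall_finset {Ω Ω' E T : Type*} [MeasurableSpace Ω] [MeasurableSpace Ω']
    [MeasurableSpace E] {P : Measure Ω} {P' : Measure Ω'} [IsFiniteMeasure P] [IsFiniteMeasure P']
    {Y : Ω → E} {Y' : Ω' → E} {f : Ω → T → ℝ} {f' : Ω' → T → ℝ}
    (hY : Measurable Y) (hY' : Measurable Y') (hf : Measurable f) (hf' : Measurable f')
    (h : ∀ I : Finset T, P.map (fun ω => (Y ω, fun x : I => f ω x)) =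
      P'.map (fun ω => (Y' ω, fun x : I => f' ω x))) :
    P.map (fun ω => (Y ω, f ω)) = P'.map (fun ω => (Y' ω, f' ω)) := by
  have hr : ∀ I : Finset T, Measurable (I.restrict : (T → ℝ) → I → ℝ) := fun I =>
    I.measurable_restrict
  refine Measure.ext_prod fun {B C} hB hC => ?_
  have key : ((P.restrict (Y ⁻¹' B)).map f) = (P'.restrict (Y' ⁻¹' B)).map f' := by
    refine IsProjectiveLimit.unique
      (P := fun I : Finset T => ((P'.restrict (Y' ⁻¹' B)).map f').map I.restrict)
      (fun I => ?_) (fun I => rfl)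
    ext D hD
    have hfI : Measurable fun ω => fun x : I => f ω x := (hr I).comp hf
    have hfI' : Measurable fun ω => fun x : I => f' ω x := (hr I).comp hf'
    have hI := DFunLike.congr_fun (h I) (B ×ˢ D)
    rw [Measure.map_apply (hY.prodMk hfI) (hB.prod hD),
      Measure.map_apply (hY'.prodMk hfI') (hB.prod hD)] at hI
    beta_reduce
    rw [Measure.map_map (hr I) hf, Measure.map_map (hr I) hf',
      Measure.map_apply ((hr I).comp hf) hD, Measure.map_apply ((hr I).comp hf') hD,
      Measure.restrict_apply (((hr I).comp hf) hD), Measure.restrict_apply (((hr I).comp hf') hD),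
      Set.inter_comm, Set.inter_comm _ (Y' ⁻¹' B)]
    exact hI
  have hC' := DFunLike.congr_fun key C
  rw [Measure.map_apply hf hC, Measure.map_apply hf' hC, Measure.restrict_apply (hf hC),
    Measure.restrict_apply (hf' hC), Set.inter_comm, Set.inter_comm _ (Y' ⁻¹' B)] at hC'
  rw [Measure.map_apply (hY.prodMk hf) (hB.prod hC), Measure.map_apply (hY'.prodMk hf')
    (hB.prod hC)]
  exact hC'

/-- Inserting a random variable `Y` into a jointly measurable random function that is independent
of `Y`: the conditional law is obtained by freezing the argument. -/
theorem exists_kernel_map_eq_compProd {Ω Z E W : Type*} [MeasurableSpace Ω] [MeasurableSpace Z]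
    [MeasurableSpace E] [MeasurableSpace W] {P : Measure Ω} [IsProbabilityMeasure P]
    {ξ : Ω → Z} (hξ : Measurable ξ) {F : E × Z → W} (hF : Measurable F) :
    ∃ κ : Kernel E W, IsMarkovKernel κ ∧ (∀ y, κ y = P.map fun ω => F (y, ξ ω)) ∧
      ∀ Y : Ω → E, Measurable Y → IndepFun Y ξ P →
        P.map (fun ω => (Y ω, F (Y ω, ξ ω))) = P.map Y ⊗ₘ κ := by
  have : IsProbabilityMeasure (P.map ξ) := Measure.isProbabilityMeasure_map hξ.aemeasurable
  have hκ : ∀ y, ((Kernel.id ×ₖ Kernel.const E (P.map ξ)).map F) y = P.map fun ω => F (y, ξ ω) := by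
    intro y
    rw [Kernel.map_apply _ hF, Kernel.prod_apply, Kernel.id_apply, Kernel.const_apply,
      Measure.dirac_prod, Measure.map_map hF measurable_prodMk_left,
      Measure.map_map (hF.comp measurable_prodMk_left) hξ]
    rfl
  have hM : IsMarkovKernel ((Kernel.id ×ₖ Kernel.const E (P.map ξ)).map F) :=
    Kernel.IsMarkovKernel.map _ hF
  refine ⟨_, hM, hκ, fun Y hY hind => ?_⟩
  have : IsProbabilityMeasure (P.map Y) := Measure.isProbabilityMeasure_map hY.aemeasurable
  have hG : Measurable fun p : E × Z => (p.1, F p) := measurable_fst.prodMk hF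
  have hlaw := (indepFun_iff_map_prod_eq_prod_map_map hY.aemeasurable hξ.aemeasurable).1 hind
  ext s hs
  rw [Measure.compProd_apply hs]
  have h1 : P.map (fun ω => (Y ω, F (Y ω, ξ ω))) =
      (P.map fun ω => (Y ω, ξ ω)).map fun p => (p.1, F p) := by
    rw [Measure.map_map hG (hY.prodMk hξ)]
    rfl
  rw [h1, hlaw, Measure.map_apply hG hs, Measure.prod_apply (hG hs)]
  refine lintegral_congr fun y => ?_
  have hFy : Measurable fun ω => F (y, ξ ω) := hF.comp (measurable_const.prodMk hξ)
  rw [hκ, Measure.map_apply hFy (measurable_prodMk_left hs),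
    Measure.map_apply hξ (measurable_prodMk_left (hG hs))]
  rfl

/-- The version of `exists_kernel_map_eq_compProd` for a random function that is measurable with
respect to a sub-σ-algebra. -/
theorem exists_kernel_map_eq_compProd_of_le {Ω E W : Type*} {m : MeasurableSpace Ω}
    [mΩ : MeasurableSpace Ω] [mE : MeasurableSpace E] [MeasurableSpace W] {P : Measure Ω}
    [IsProbabilityMeasure P] (hm : m ≤ mΩ) {F : E × Ω → W} (hF : Measurable[mE.prod m] F) :
    ∃ κ : Kernel E W, IsMarkovKernel κ ∧ (∀ y, κ y = P.map fun ω => F (y, ω)) ∧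
      ∀ Y : Ω → E, Measurable Y → Indep (mE.comap Y) m P →
        P.map (fun ω => (Y ω, F (Y ω, ω))) = P.map Y ⊗ₘ κ := by
  obtain ⟨κ, h1, h2, h3⟩ := @exists_kernel_map_eq_compProd Ω Ω E W mΩ m _ _ P _ id
    (measurable_id'' hm) F hF
  refine ⟨κ, h1, h2, fun Y hY hind => h3 Y hY ?_⟩
  rw [@IndepFun_iff_Indep, MeasurableSpace.comap_id]
  exact hind

/-- The regular conditional distribution given `r ∘ Y`, when `r ∘ Y` generates the same σ-algebra
as `Y`, is characterised by disintegration of the joint law with `Y`. -/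
theorem map_prodMk_eq_compProd_iff {Ω E E' W : Type*} [MeasurableSpace Ω]
    [mE : MeasurableSpace E] [mE' : MeasurableSpace E'] [MeasurableSpace W] [StandardBorelSpace W]
    [Nonempty W] {P : Measure Ω} [IsFiniteMeasure P] {Y : Ω → E} (hY : Measurable Y)
    {r : E → E'} (hr : Measurable r) (hle : mE.comap Y ≤ mE'.comap (fun ω => r (Y ω)))
    {f : Ω → W} (hf : Measurable f) (κ : Kernel E W) [IsMarkovKernel κ] :
    P.map (fun ω => (Y ω, f ω)) = P.map Y ⊗ₘ κ ↔
      ∀ᵐ ω ∂P, condDistrib f (fun ω => r (Y ω)) P (r (Y ω)) = κ (Y ω) := by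
  have key : ∀ (η : Kernel E W) [IsMarkovKernel η],
      (∀ᵐ ω ∂P, condDistrib f (fun ω => r (Y ω)) P (r (Y ω)) = η (Y ω)) →
      P.map (fun ω => (Y ω, f ω)) = P.map Y ⊗ₘ η := by
    intro η _ hη
    refine Measure.ext_prod fun {B C} hB hC => ?_
    have hrY : Measurable fun ω => r (Y ω) := hr.comp hY
    rw [Measure.map_apply (hY.prodMk hf) (hB.prod hC), Measure.compProd_apply_prod hB hC,
      setLIntegral_map hB (Kernel.measurable_coe _ hC) hY,
      ← lintegral_congr_ae (ae_restrict_of_ae (hη.mono fun ω hω => congrArg (fun μ => μ C) hω)),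
      setLIntegral_condDistrib_of_measurableSet hrY hf.aemeasurable hC
        (hle _ ⟨B, hB, rfl⟩)]
    rfl
  refine ⟨fun h => ?_, key κ⟩
  have h0 := key ((condDistrib f (fun ω => r (Y ω)) P).comap r hr)
    (Filter.Eventually.of_forall fun ω => by rw [Kernel.comap_apply])
  have := ae_of_ae_map hY.aemeasurable (Kernel.ae_eq_of_compProd_eq (h0.symm.trans h))
  filter_upwards [this] with ω hω
  rw [← hω, Kernel.comap_apply]

/-- If two independent families are independent of each other, the pairs are independent. -/
theorem iIndep_sup_of_indepFun {Ω ι : Type*} {α β : ι → Type*} [mΩ : MeasurableSpace Ω]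
    [mα : ∀ i, MeasurableSpace (α i)] [mβ : ∀ i, MeasurableSpace (β i)] {P : Measure Ω}
    [IsProbabilityMeasure P] {X : Ω → ∀ i, α i} {Y : Ω → ∀ i, β i}
    (hXm : ∀ i, Measurable fun ω => X ω i) (hYm : ∀ i, Measurable fun ω => Y ω i)
    (hX : iIndepFun (fun i ω => X ω i) P) (hY : iIndepFun (fun i ω => Y ω i) P)
    (hXY : IndepFun X Y P) :
    iIndep (fun i => (mα i).comap (fun ω => X ω i) ⊔ (mβ i).comap (fun ω => Y ω i)) P := by
  classical
  refine iIndepSets.iIndep (fun i => sup_le (hXm i).comap_le (hYm i).comap_le)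
    (fun i => {w | ∃ s t, MeasurableSet s ∧ MeasurableSet t ∧
      w = (fun ω => X ω i) ⁻¹' s ∩ (fun ω => Y ω i) ⁻¹' t}) (fun i => ?_) (fun i => ?_) ?_
  · rintro _ ⟨s, t, hs, ht, rfl⟩ _ ⟨s', t', hs', ht', rfl⟩ -
    refine ⟨s ∩ s', t ∩ t', hs.inter hs', ht.inter ht', ?_⟩
    rw [Set.preimage_inter, Set.preimage_inter, Set.inter_inter_inter_comm]
  · apply le_antisymm
    · refine sup_le ?_ ?_
      · rintro _ ⟨s, hs, rfl⟩
        exact MeasurableSpace.measurableSet_generateFrom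
          ⟨s, Set.univ, hs, MeasurableSet.univ, by simp⟩
      · rintro _ ⟨t, ht, rfl⟩
        exact MeasurableSpace.measurableSet_generateFrom
          ⟨Set.univ, t, MeasurableSet.univ, ht, by simp⟩
    · refine MeasurableSpace.generateFrom_le ?_
      rintro _ ⟨s, t, hs, ht, rfl⟩
      exact MeasurableSet.inter (le_sup_left (a := (mα i).comap (fun ω => X ω i)) _ ⟨s, hs, rfl⟩)
        (le_sup_right (b := (mβ i).comap (fun ω => Y ω i)) _ ⟨t, ht, rfl⟩)
  · rw [iIndepSets_iff]
    intro J w hw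
    choose! s t hs ht hst using hw
    have hpre : ∀ J' ⊆ J, (P (⋂ i ∈ J', w i)) =
        P (⋂ i ∈ J', (fun ω => X ω i) ⁻¹' s i) * P (⋂ i ∈ J', (fun ω => Y ω i) ⁻¹' t i) := by
      intro J' hJ'
      have hsm : MeasurableSet (⋂ i ∈ J', (fun z : ∀ i, α i => z i) ⁻¹' s i) :=
        Finset.measurableSet_biInter _ fun i hi => measurable_pi_apply i (hs i (hJ' hi))
      have htm : MeasurableSet (⋂ i ∈ J', (fun z : ∀ i, β i => z i) ⁻¹' t i) :=
        Finset.measurableSet_biInter _ fun i hi => measurable_pi_apply i (ht i (hJ' hi))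
      have := hXY.measure_inter_preimage_eq_mul _ _ hsm htm
      simp only [Set.preimage_iInter, ← Set.preimage_comp] at this
      have hw' : ⋂ i ∈ J', w i = (⋂ i ∈ J', (fun ω => X ω i) ⁻¹' s i) ∩
          (⋂ i ∈ J', (fun ω => Y ω i) ⁻¹' t i) := by
        simp_rw [← Set.iInter_inter_distrib]
        exact Set.iInter₂_congr fun i hi => hst i (hJ' hi)
      rw [hw']
      exact this
    rw [hpre J subset_rfl, hX.measure_inter_preimage_eq_mul J hs,
      hY.measure_inter_preimage_eq_mul J ht, ← Finset.prod_mul_distrib]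
    refine Finset.prod_congr rfl fun i hi => ?_
    have := hpre {i} (by simpa using hi)
    simpa using this.symm

end Laws

end GPAR
namespace GPAR

section Truncation

variable {D M : ℕ} {S : Set (Input D → ℝ)}

/-- The inclusion of `S^M` into the space of all functions. -/
def toPaths (f : Fin M → S) : Paths D (Fin M) := fun j => f j

theorem measurable_toPaths : Measurable (toPaths : (Fin M → S) → Paths D (Fin M)) :=
  measurable_pi_lambda _ fun j => measurable_subtype_coe.comp (measurable_pi_apply j)

theorem measurableSpace_eq_comap_toPaths :
    (inferInstance : MeasurableSpace (Fin M → S)) =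
      (inferInstance : MeasurableSpace (Paths D (Fin M))).comap toPaths := by
  refine le_antisymm ?_ measurable_toPaths.comap_le
  have h : Measurable[(inferInstance : MeasurableSpace (Paths D (Fin M))).comap toPaths]
      (id : (Fin M → S) → Fin M → S) := by
    refine @measurable_pi_lambda _ _ _ (_) _ _ fun j => ?_
    refine @Measurable.subtype_mk _ _ (_) _ _ _ ?_ (fun f => (f j).2)
    exact (measurable_pi_apply j).comp (comap_measurable toPaths)
  simpa only [MeasurableSpace.comap_id] using h.comap_le

/-- Keep the components of `f` with index less than `n`, and replace the others by `s₀`. -/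
def truncate (s₀ : S) (n : ℕ) (f : Fin M → S) : Fin M → S :=
  fun j => if (j : ℕ) < n then f j else s₀

theorem measurable_truncate (s₀ : S) (n : ℕ) :
    Measurable (truncate s₀ n : (Fin M → S) → Fin M → S) := by
  refine measurable_pi_lambda _ fun j => ?_
  unfold truncate
  split_ifs
  · exact measurable_pi_apply j
  · exact measurable_const

theorem truncate_of_lt (s₀ : S) {n : ℕ} (f : Fin M → S) {j : Fin M} (h : (j : ℕ) < n) :
    truncate s₀ n f j = f j := if_pos h

theorem truncate_self (s₀ : S) (f : Fin M → S) : truncate s₀ M f = f :=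
  funext fun j => truncate_of_lt s₀ f j.2

theorem truncate_zero (s₀ : S) (f : Fin M → S) : truncate s₀ 0 f = fun _ => s₀ :=
  funext fun _ => if_neg (Nat.not_lt_zero _)

theorem preceding_toPaths_truncate (s₀ : S) (i : Fin M) (f : Fin M → S) :
    preceding i (toPaths (truncate s₀ i f)) = preceding i (toPaths f) := by
  funext j
  exact congrArg Subtype.val (truncate_of_lt s₀ f j.2)

theorem measurable_preceding (i : Fin M) : Measurable (preceding (D := D) i) :=
  measurable_pi_lambda _ fun j => measurable_pi_apply (j : Fin M)

/-- The truncation at `i` is measurable with respect to the components before `i`. -/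
theorem comap_truncate_le {Ω : Type*} (s₀ : S) (i : Fin M) (f : Ω → Fin M → S) :
    (inferInstance : MeasurableSpace (Fin M → S)).comap (fun ω => truncate s₀ i (f ω)) ≤
      (inferInstance : MeasurableSpace (Paths D (Set.Iio i))).comap
        (fun ω => preceding i (toPaths (truncate s₀ i (f ω)))) := by
  rw [← measurable_iff_comap_le]
  refine @measurable_pi_lambda _ _ _ (_) _ _ fun j => ?_
  by_cases hj : (j : ℕ) < i
  · refine @Measurable.subtype_mk _ _ (_) _ _
      (fun ω => (truncate s₀ i (f ω) j : Input D → ℝ)) ?_ (fun ω => (truncate s₀ i (f ω) j).2)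
    exact (measurable_pi_apply (X := fun _ : Set.Iio i => Input D → ℝ) ⟨j, hj⟩).comp
      (comap_measurable _)
  · simp only [truncate, hj, if_false]
    exact measurable_const

variable {Ω Ω' : Type*} [MeasurableSpace Ω] [MeasurableSpace Ω']

/-- The law of a process is determined by the conditional finite-dimensional laws of each component
given the previous ones. -/
theorem map_eq_of_forall_disintegration {P : Measure Ω} {P' : Measure Ω'} [IsProbabilityMeasure P]
    [IsProbabilityMeasure P'] (s₀ : S) {f : Ω → Fin M → S} {f' : Ω' → Fin M → S}
    (hf : Measurable f) (hf' : Measurable f')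
    (κ : Fin M → ∀ I : Finset (Input D), Kernel (Fin M → S) (I → ℝ))
    (h : ∀ (i : Fin M) (I : Finset (Input D)), P.map (fun ω => (truncate s₀ i (f ω), fun x : I => (f ω i : Input D → ℝ) x)) =
      P.map (fun ω => truncate s₀ i (f ω)) ⊗ₘ κ i I)
    (h' : ∀ (i : Fin M) (I : Finset (Input D)), P'.map (fun ω => (truncate s₀ i (f' ω), fun x : I => (f' ω i : Input D → ℝ) x)) =
      P'.map (fun ω => truncate s₀ i (f' ω)) ⊗ₘ κ i I) :
    P.map f = P'.map f' := by
  have hft : ∀ n : ℕ, Measurable fun ω => truncate s₀ n (f ω) :=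
    fun n => (measurable_truncate s₀ n).comp hf
  have hft' : ∀ n : ℕ, Measurable fun ω => truncate s₀ n (f' ω) :=
    fun n => (measurable_truncate s₀ n).comp hf'
  have hfc : ∀ i, Measurable fun ω => (f ω i : Input D → ℝ) :=
    fun i => measurable_subtype_coe.comp ((measurable_pi_apply i).comp hf)
  have hfc' : ∀ i, Measurable fun ω => (f' ω i : Input D → ℝ) :=
    fun i => measurable_subtype_coe.comp ((measurable_pi_apply i).comp hf')
  have key : ∀ n ≤ M, P.map (fun ω => truncate s₀ n (f ω)) =
      P'.map (fun ω => truncate s₀ n (f' ω)) := by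
    intro n
    induction n with
    | zero => intro _; simp [truncate_zero]
    | succ n ih =>
      intro hn
      let i : Fin M := ⟨n, hn⟩
      have hi := ih (Nat.le_of_succ_le hn)
      have hjoint := map_prodMk_eq_of_forall_finset (hft n) (hft' n) (hfc i) (hfc' i)
        (fun I => ((h i I).trans (congrArg (fun μ => μ ⊗ₘ κ i I) hi)).trans (h' i I).symm)
      let Φ : (Fin M → S) × (Input D → ℝ) → Paths D (Fin M) :=
        fun p j => if j = i then p.2 else p.1 j
      have hΦ : Measurable Φ := by
        refine measurable_pi_lambda _ fun j => ?_
        by_cases hj : j = i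
        · simpa only [Φ, hj, if_true] using measurable_snd
        · simp only [Φ, hj, if_false]
          exact measurable_subtype_coe.comp ((measurable_pi_apply j).comp measurable_fst)
      have hstep : ∀ y : Fin M → S, toPaths (truncate s₀ (n + 1) y) =
          Φ (truncate s₀ n y, (y i : Input D → ℝ)) := by
        intro y
        funext j
        by_cases hj : j = i
        · subst hj
          simp [toPaths, Φ, truncate, i]
        · have : (j : ℕ) ≠ n := fun e => hj (Fin.ext e)
          have h2 : (j : ℕ) < n + 1 ↔ (j : ℕ) < n := by omega
          simp only [toPaths, Φ, truncate, hj, if_false, h2]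
      refine map_injective_of_eq_comap measurableSpace_eq_comap_toPaths ?_
      rw [Measure.map_map measurable_toPaths (hft _), Measure.map_map measurable_toPaths (hft' _)]
      have e1 := congrArg (fun μ => μ.map Φ) hjoint
      beta_reduce at e1
      rw [Measure.map_map hΦ ((hft n).prodMk (hfc i)),
        Measure.map_map hΦ ((hft' n).prodMk (hfc' i))] at e1
      have e2 : (toPaths ∘ fun ω => truncate s₀ (n + 1) (f ω)) =
          Φ ∘ fun ω => (truncate s₀ n (f ω), (f ω i : Input D → ℝ)) :=
        funext fun ω => hstep (f ω)
      have e3 : (toPaths ∘ fun ω => truncate s₀ (n + 1) (f' ω)) =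
          Φ ∘ fun ω => (truncate s₀ n (f' ω), (f' ω i : Input D → ℝ)) :=
        funext fun ω => hstep (f' ω)
      rw [e2, e3]
      exact e1
  simpa only [truncate_self] using key M le_rfl

/-- A component is conditionally Gaussian given the previous ones iff the joint law disintegrates
along a kernel of centred Gaussian laws with the prescribed covariances. -/
theorem isCondGP_iff {P : Measure Ω} [IsProbabilityMeasure P] (s₀ : S) {f : Ω → Fin M → S}
    (hf : Measurable f) (i : Fin M) {k : Paths D (Set.Iio i) → Input D → Input D → ℝ}
    (κ : ∀ I : Finset (Input D), Kernel (Fin M → S) (I → ℝ)) [∀ I, IsMarkovKernel (κ I)]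
    (hκ : ∀ I y, IsCenteredGaussian (κ I y) fun x x' => k (preceding i (toPaths y)) x x') :
    IsCondGP (fun ω => toPaths (f ω) i) (fun ω => preceding i (toPaths (f ω))) k P ↔
      ∀ I : Finset (Input D), P.map (fun ω => (truncate s₀ i (f ω), fun x : I => (f ω i : Input D → ℝ) x)) =
        P.map (fun ω => truncate s₀ i (f ω)) ⊗ₘ κ I := by
  refine forall_congr' fun I => ?_
  have hfI : Measurable fun ω => fun x : I => (f ω i : Input D → ℝ) x :=
    measurable_pi_lambda _ fun x => (measurable_pi_apply (x : Input D)).comp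
      (measurable_subtype_coe.comp ((measurable_pi_apply i).comp hf))
  rw [map_prodMk_eq_compProd_iff (Y := fun ω => truncate s₀ i (f ω))
    (r := fun y => preceding i (toPaths y)) ((measurable_truncate s₀ i).comp hf)
    ((measurable_preceding i).comp measurable_toPaths)
    (comap_truncate_le s₀ i f) hfI (κ I)]
  simp only [preceding_toPaths_truncate]
  refine Filter.eventually_congr (Filter.Eventually.of_forall fun ω => ?_)
  have hω := hκ I (truncate s₀ i (f ω))
  rw [preceding_toPaths_truncate] at hω
  exact ⟨fun h => h.unique hω, fun h => by rw [← h] at hω; exact hω⟩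

end Truncation

section Model

variable {D M : ℕ} {S : Set (Input D → ℝ)}

/-- `T^{M-1} u` is a fixed point of `T`, because `A_i(x, y)` depends on `y_{1:i-1}` only. -/
theorem opT_iterate_fixed {a : Fin M → Input D × Paths D (Fin M) → ℝ} {v : Paths D (Fin M)}
    (hdep : ∀ i x, DependsOn (fun y : Paths D (Fin M) => a i (x, y)) (Set.Iio i))
    (h0 : ∀ i : Fin M, (i : ℕ) = 0 → a i = 0) :
    opT a v ((opT a v)^[M - 1] v) = (opT a v)^[M - 1] v := by
  have key : ∀ n : ℕ, ∀ j : Fin M, (j : ℕ) ≤ n →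
      (opT a v)^[n + 1] v j = (opT a v)^[n] v j := by
    intro n
    induction n with
    | zero =>
      intro j hj
      funext x
      simp [opT, comp, h0 j (Nat.le_zero.1 hj)]
    | succ n ih =>
      intro j hj
      rw [Function.iterate_succ_apply', Function.iterate_succ_apply' _ n]
      funext x
      refine congrArg (v j x + ·) (hdep j x fun k hk => ?_)
      rw [← Function.iterate_succ_apply' (opT a v)]
      refine ih k ?_
      have : (k : ℕ) < j := hk
      omega
  rw [← Function.iterate_succ_apply' (opT a v)]
  exact funext fun j => key (M - 1) j (by omega)

theorem opT_iterate_mem {a : Fin M → Input D × Paths D (Fin M) → ℝ} {v : Paths D (Fin M)}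
    (hv : ∀ i, v i ∈ S) (hT : ∀ f : Paths D (Fin M), (∀ i, f i ∈ S) → ∀ i, opT a v f i ∈ S)
    (n : ℕ) : ∀ i, (opT a v)^[n] v i ∈ S := by
  induction n with
  | zero => exact hv
  | succ n ih =>
    rw [Function.iterate_succ_apply']
    exact hT _ ih

variable {Ω : Type*}

/-- The σ-algebra generated by `A_i` and `u_i`. -/
abbrev innovation (A : Ω → Fin M → Input D × Paths D (Fin M) → ℝ) (u : Ω → Paths D (Fin M))
    (i : Fin M) : MeasurableSpace Ω :=
  MeasurableSpace.comap (fun ω => A ω i) inferInstance ⊔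
    MeasurableSpace.comap (fun ω => u ω i) inferInstance

variable {A : Ω → Fin M → Input D × Paths D (Fin M) → ℝ} {u : Ω → Paths D (Fin M)}

/-- For a frozen second argument, `u_i + A_i(·, y)` is jointly measurable in `(y, ω)` with respect to
the σ-algebra generated by `A_i` and `u_i`. -/
theorem measurable_innovation_add {i : Fin M} (hA : JointlyMeasurable S fun ω => A ω i)
    (x : Input D) :
    Measurable[(inferInstance : MeasurableSpace (Fin M → S)).prod (innovation A u i)]
      (fun p : (Fin M → S) × Ω => u p.2 i x + A p.2 i (x, toPaths p.1)) := by
  refine @Measurable.add _ _ _ _ _ (_) _ _ ?_ ?_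
  · have h1 : Measurable[innovation A u i] fun ω => u ω i x :=
      ((measurable_pi_apply x).comp (comap_measurable fun ω => u ω i)).mono le_sup_right le_rfl
    exact h1.comp (@measurable_snd _ _ _ (innovation A u i))
  · have h1 : @Measurable _ _ (MeasurableSpace.prod inferInstance (innovation A u i))
        (MeasurableSpace.prod (MeasurableSpace.comap (fun ω => A ω i) inferInstance) inferInstance)
        (fun p : (Fin M → S) × Ω => (p.2, p.1)) := by
      refine @Measurable.prodMk _ _ _ _ (_) (_) _ _ ?_ ?_
      · exact (@measurable_snd _ _ _ (innovation A u i)).mono le_rfl le_sup_left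
      · exact @measurable_fst _ _ _ (innovation A u i)
    exact (hA x).comp h1

/-- A solution of `h = T h` has components before `n` that are functions of the `A_j` and `u_j` with
`j < n`. -/
theorem measurable_truncate_of_fixed (s₀ : S) (hAmeas : ∀ i, JointlyMeasurable S fun ω => A ω i)
    (hAdep : ∀ ω i x, DependsOn (fun y : Paths D (Fin M) => A ω i (x, y)) (Set.Iio i))
    {h : Ω → Fin M → S}
    (hfix : ∀ ω i x, (h ω i : Input D → ℝ) x = u ω i x + A ω i (x, toPaths (h ω))) (n : ℕ) :
    Measurable[⨆ j ∈ {j : Fin M | (j : ℕ) < n}, innovation A u j]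
      (fun ω => truncate s₀ n (h ω)) := by
  induction n with
  | zero =>
    simp only [truncate_zero]
    exact measurable_const
  | succ n ih =>
    have hmono : (⨆ j ∈ {j : Fin M | (j : ℕ) < n}, innovation A u j) ≤
        ⨆ j ∈ {j : Fin M | (j : ℕ) < n + 1}, innovation A u j :=
      biSup_mono fun j (hj : (j : ℕ) < n) => Nat.lt_succ_of_lt hj
    have ih' := ih.mono hmono le_rfl
    refine @measurable_pi_lambda _ _ _ (_) _ _ fun j => ?_
    rcases lt_trichotomy (j : ℕ) n with hj | hj | hj
    · have h1 : (fun ω => truncate s₀ (n + 1) (h ω) j) = fun ω => truncate s₀ n (h ω) j :=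
        funext fun ω => by
          rw [truncate_of_lt _ _ hj, truncate_of_lt _ _ (Nat.lt_succ_of_lt hj)]
      rw [h1]
      exact (measurable_pi_apply j).comp ih'
    · have hle : innovation A u j ≤ ⨆ j ∈ {j : Fin M | (j : ℕ) < n + 1}, innovation A u j :=
        le_biSup (innovation A u) (show (j : ℕ) < n + 1 by omega)
      refine @Measurable.subtype_mk _ _ (_) _ _
        (fun ω => (truncate s₀ (n + 1) (h ω) j : Input D → ℝ)) ?_
        (fun ω => (truncate s₀ (n + 1) (h ω) j).2)
      refine @measurable_pi_lambda _ _ _ (_) _ _ fun x => ?_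
      have h1 : (fun ω => (truncate s₀ (n + 1) (h ω) j : Input D → ℝ) x) =
          fun ω => u ω j x + A ω j (x, toPaths (truncate s₀ n (h ω))) := by
        funext ω
        rw [truncate_of_lt _ _ (show (j : ℕ) < n + 1 by omega), hfix]
        refine congrArg (u ω j x + ·) (hAdep ω j x fun k hk => ?_)
        have : (k : ℕ) < j := hk
        exact congrArg Subtype.val (truncate_of_lt s₀ (h ω) (by omega)).symm
      rw [h1]
      have h2 : @Measurable _ _ (⨆ j ∈ {j : Fin M | (j : ℕ) < n + 1}, innovation A u j)
          (MeasurableSpace.prod inferInstance (innovation A u j))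
          (fun ω => (truncate s₀ n (h ω), ω)) :=
        @Measurable.prodMk _ (_) _ _ _ (innovation A u j) (fun ω => truncate s₀ n (h ω))
          (fun ω => ω) ih' (measurable_id'' hle)
      exact (measurable_innovation_add (u := u) (hAmeas j) x).comp h2
    · have h1 : ¬ ((j : ℕ) < n + 1) := by omega
      simp only [truncate, h1, if_false]
      exact measurable_const

/-- The joint laws of the solution of `h = T h` disintegrate along the laws of
`u_i + A_i(·, y)`. -/
theorem exists_kernel_of_fixed [mΩ : MeasurableSpace Ω] {P : Measure Ω} [IsProbabilityMeasure P] (s₀ : S)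
    (hAm : ∀ i, Measurable fun ω => A ω i) (hum : ∀ i, Measurable fun ω => u ω i)
    (hind : iIndep (innovation A u) P) (hAmeas : ∀ i, JointlyMeasurable S fun ω => A ω i)
    (hAdep : ∀ ω i x, DependsOn (fun y : Paths D (Fin M) => A ω i (x, y)) (Set.Iio i))
    {h : Ω → Fin M → S}
    (hfix : ∀ ω i x, (h ω i : Input D → ℝ) x = u ω i x + A ω i (x, toPaths (h ω)))
    (i : Fin M) (I : Finset (Input D)) :
    ∃ κ : Kernel (Fin M → S) (I → ℝ), IsMarkovKernel κ ∧
      (∀ y, κ y = P.map fun ω (x : I) => u ω i x + A ω i (x, toPaths y)) ∧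
      P.map (fun ω => (truncate s₀ i (h ω), fun x : I => (h ω i : Input D → ℝ) x)) =
        P.map (fun ω => truncate s₀ i (h ω)) ⊗ₘ κ := by
  have hle : ∀ j, innovation A u j ≤ mΩ := fun j => sup_le (hAm j).comap_le (hum j).comap_le
  obtain ⟨κ, hκM, hκ, hjoint⟩ := exists_kernel_map_eq_compProd_of_le (P := P) (hle i)
    (F := fun (p : (Fin M → S) × Ω) (x : I) => u p.2 i x + A p.2 i (x, toPaths p.1))
    (@measurable_pi_lambda _ _ _ (_) _ _ fun x => measurable_innovation_add (hAmeas i) x)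
  refine ⟨κ, hκM, hκ, ?_⟩
  have hpast := measurable_truncate_of_fixed s₀ hAmeas hAdep hfix i
  have hdisj := indep_iSup_of_disjoint hle hind
    (S := {j : Fin M | (j : ℕ) < i}) (T := {i}) (by simp)
  rw [iSup_singleton] at hdisj
  have := hjoint (fun ω => truncate s₀ i (h ω))
    (hpast.mono (iSup₂_le fun j _ => hle j) le_rfl)
    (indep_of_indep_of_le_left hdisj hpast.comap_le)
  rw [← this]
  congr 1
  funext ω
  refine Prod.ext rfl (funext fun x => ?_)
  refine (hfix ω i x).trans (congrArg (u ω i x + ·) (hAdep ω i x fun k hk => ?_))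
  exact congrArg Subtype.val (truncate_of_lt s₀ (h ω) hk).symm

end Model

end GPAR

open GPAR
theorem lemma1 {D M : ℕ}
    {Ω : Type*} [MeasurableSpace Ω] (P : Measure Ω) [IsProbabilityMeasure P]
    -- the latent processes and their kernels; `kA i` is a function of `(x, y_{1:i-1})` only
    (A : Ω → Fin M → Input D × Paths D (Fin M) → ℝ)
    (u : Ω → Paths D (Fin M))
    (kA : (i : Fin M) → Input D × Paths D (Set.Iio i) → Input D × Paths D (Set.Iio i) → ℝ)
    (ku : Fin M → Input D → Input D → ℝ)
    (hA : ∀ i, IsGP (fun ω => A ω i)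
      (fun p q => kA i (p.1, preceding i p.2) (q.1, preceding i q.2)) P)
    (hu : ∀ i, IsGP (fun ω => u ω i) (ku i) P)
    -- all of `A_1, …, A_M, u_1, …, u_M` are independent
    (hAind : iIndepFun (fun i ω => A ω i) P)
    (huind : iIndepFun (fun i ω => u ω i) P)
    (hAu : IndepFun A u P)
    -- `A_i(x, y)` depends only on `(x, y_{1:i-1})`, and `A_1 = 0`
    (hAdep : ∀ ω i x, DependsOn (fun y : Paths D (Fin M) => A ω i (x, y)) (Set.Iio i))
    (hA1 : ∀ ω (i : Fin M), (i : ℕ) = 0 → A ω i = 0)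
    -- regularity: the sample paths lie in a set `S` (for instance `Set.univ`), and on `S` the
    -- random functions `A_i` are jointly measurable
    (S : Set (Input D → ℝ))
    (hSu : ∀ ω i, u ω i ∈ S)
    (hST : ∀ ω (f : Paths D (Fin M)), (∀ i, f i ∈ S) → ∀ i, opT (A ω) (u ω) f i ∈ S)
    (hAmeas : ∀ i, JointlyMeasurable S (fun ω => A ω i))
    -- the process `g`, on a probability space of its own
    {Ω' : Type*} [MeasurableSpace Ω'] (P' : Measure Ω') [IsProbabilityMeasure P']
    (g : Ω' → Paths D (Fin M))
    (hg : ∀ i x, Measurable (fun ω => g ω i x))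
    (hSg : ∀ ω i, g ω i ∈ S) :
    IdentDistrib g (fun ω => (opT (A ω) (u ω))^[M - 1] (u ω)) P' P ↔
      ∀ i, IsCondGP (fun ω => g ω i) (fun ω => preceding i (g ω))
        (fun y x x' => ku i x x' + kA i (x, y) (x', y)) P' := by
  cases isEmpty_or_nonempty (Fin M) with
  | inl hM =>
    refine iff_of_true ?_ fun i => (IsEmpty.false i).elim
    have h1 : g = fun _ => isEmptyElim := funext fun _ => Subsingleton.elim _ _
    have h2 : (fun ω => (opT (A ω) (u ω))^[M - 1] (u ω)) = fun _ => isEmptyElim :=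
      funext fun _ => Subsingleton.elim _ _
    rw [h1, h2]
    exact ⟨measurable_const.aemeasurable, measurable_const.aemeasurable, by simp⟩
  | inr hM =>
  obtain ⟨i₀⟩ := hM
  obtain ⟨ω₀⟩ : Nonempty Ω := nonempty_of_isProbabilityMeasure P
  let s₀ : S := ⟨u ω₀ i₀, hSu ω₀ i₀⟩
  have hAm : ∀ i, Measurable fun ω => A ω i := fun i => measurable_pi_lambda _ (hA i).measurable
  have hum : ∀ i, Measurable fun ω => u ω i := fun i => measurable_pi_lambda _ (hu i).measurable
  let h : Ω → Fin M → S := fun ω i =>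
    ⟨(opT (A ω) (u ω))^[M - 1] (u ω) i, opT_iterate_mem (hSu ω) (hST ω) (M - 1) i⟩
  let f : Ω' → Fin M → S := fun ω i => ⟨g ω i, hSg ω i⟩
  have hfix : ∀ ω i x, (h ω i : Input D → ℝ) x = u ω i x + A ω i (x, toPaths (h ω)) :=
    fun ω i x => (congrFun (congrFun (opT_iterate_fixed (hAdep ω) (hA1 ω)) i) x).symm
  have hind : iIndep (innovation A u) P := iIndep_sup_of_indepFun hAm hum hAind huind hAu
  have hhm : Measurable h := by
    have := (measurable_truncate_of_fixed s₀ hAmeas hAdep hfix M).mono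
      (iSup₂_le fun j _ => sup_le (hAm j).comap_le (hum j).comap_le) le_rfl
    simpa only [truncate_self] using this
  have hfm : Measurable f := measurable_pi_lambda _ fun i =>
    (measurable_pi_lambda _ (hg i)).subtype_mk
  choose κ hκM hκ hκh using exists_kernel_of_fixed s₀ hAm hum hind hAmeas hAdep hfix
  have hgauss : ∀ i I y, IsCenteredGaussian (κ i I y) fun x x' =>
      ku i x x' + kA i (x, preceding i (toPaths y)) (x', preceding i (toPaths y)) := by
    intro i I y
    rw [hκ]
    exact isCenteredGaussian_map_add (hu i) (hA i)
      (hAu.symm.comp (measurable_pi_apply i) (measurable_pi_apply i)) (fun x : I => (x : Input D))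
      fun x : I => ((x : Input D), toPaths y)
  have hcond := fun i => isCondGP_iff (P := P') s₀ hfm i
    (k := fun y x x' => ku i x x' + kA i (x, y) (x', y)) (κ i) (hgauss i)
  constructor
  · intro hid i
    have hlaw : P'.map f = P.map h := by
      refine map_injective_of_eq_comap measurableSpace_eq_comap_toPaths ?_
      rw [Measure.map_map measurable_toPaths hfm, Measure.map_map measurable_toPaths hhm]
      exact hid.map_eq
    refine (hcond i).2 fun I => ?_
    have hΦ : Measurable fun (y : Fin M → S) =>
        (truncate s₀ i y, fun x : I => (y i : Input D → ℝ) x) :=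
      (measurable_truncate s₀ i).prodMk (measurable_pi_lambda _ fun x =>
        (measurable_pi_apply (x : Input D)).comp
          (measurable_subtype_coe.comp (measurable_pi_apply i)))
    have e1 := Measure.map_map (μ := P') hΦ hfm
    have e2 := Measure.map_map (μ := P) hΦ hhm
    have e3 := Measure.map_map (μ := P') (measurable_truncate s₀ i) hfm
    have e4 := Measure.map_map (μ := P) (measurable_truncate s₀ i) hhm
    rw [hlaw] at e1 e3
    exact (e1.symm.trans e2).trans ((hκh i I).trans
      (congrArg (fun μ => μ ⊗ₘ κ i I) (e4.symm.trans e3)))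
  · intro hc
    have hlaw : P'.map f = P.map h :=
      map_eq_of_forall_disintegration s₀ hfm hhm κ (fun i => (hcond i).1 (hc i)) hκh
    refine ⟨(measurable_toPaths.comp hfm).aemeasurable,
      (measurable_toPaths.comp hhm).aemeasurable, ?_⟩
    have := congrArg (fun μ => μ.map toPaths) hlaw
    beta_reduce at this
    rwa [Measure.map_map measurable_toPaths hfm, Measure.map_map measurable_toPaths hhm] at this
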